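/- All graphs are finite, simple and undirected. For a graph $G$ let $e(G)$ be its number of edges, and for a vertex $v$ let $E_G(v)$ be the set of edges incident with $v$. A $k$-matching of $G$ is a function $f\colon E(G)\to\{0,1,\dots,k\}$ with $\sum_{e\in E_G(v)}f(e)\le k$ for every vertex $v$. For $k\ge 3$ odd, $1\le d\le k$ and $|V(G)|\equiv d \pmod 2$, the graph $G$ is $k$-$d$-critical if for every $v\in V(G)$ there is a $k$-matching $f$ with $\sum_{e\in E_G(v)}f(e)=k-d$ and $\sum_{e\in E_G(u)}f(e)=k$ for all $u\in V(G)\setminus\{v\}$. Write $G_1+G_2$ for the disjoint union of two graphs, $G_1\vee G_2$ for their join (the disjoint union together with all edges between the two vertex sets), $K_m$ for the complete graph on $m$ vertices, and $mK_1$ for the graph with $m$ vertices and no edges. **Theorem.** Let $G$ be a graph of order $n\ge 3$, let $k\ge 3$ be odd, and let $1\le d<k$ with $n\equiv d\pmod 2$. 1. If $n\ge 9$ or $n\in\{3,7\}$, and $e(G)\ge\binom{n-1}{2}+1$, then $G$ is $k$-$d$-critical if and only if $G\not\cong K_1\vee(K_{n-2}+K_1)$. 2. If $n\in\{4,6\}$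 and $e(G)\ge\frac{3n^2-2n}{8}$, then $G$ is $k$-$d$-critical if and only if $G\not\cong K_{n/2}\vee\frac n2K_1$. 3. If $n=5$ and $e(G)\ge 7$, then $G$ is $k$-$d$-critical if and only if $G\not\cong K_2\vee 3K_1$ and $G\not\cong K_1\vee(K_3+K_1)$. 4. If $n=8$ and $e(G)\ge 22$, then $G$ is $k$-$d$-critical if and only if $G\not\cong K_4\vee 4K_1$ and $G\not\cong K_1\vee(K_6+K_1)$. -/

import Mathlib

namespace SimpleGraph

/-- The join `G ∨ H` of two vertex-disjoint graphs: their disjoint union together with all edges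
between the two vertex sets. -/
def join {V W : Type*} (G : SimpleGraph V) (H : SimpleGraph W) : SimpleGraph (V ⊕ W) :=
  (G ⊕g H) ⊔ completeBipartiteGraph V W

/-- The sum of the values of `f` over the edges of `G` incident with `v`. -/
def edgeLoad {V : Type*} [Fintype V] [DecidableEq V] (G : SimpleGraph V) [DecidableRel G.Adj]
    (f : G.edgeSet → ℕ) (v : V) : ℕ :=
  ∑ e ∈ (Finset.univ : Finset G.edgeSet).filter (fun e => v ∈ e.val), f e

/-- `f : E(G) → {0, 1, …, k}` is a `k`-matching if its sum at every vertex is at most `k`. -/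
def IsKMatching {V : Type*} [Fintype V] [DecidableEq V] (G : SimpleGraph V) [DecidableRel G.Adj]
    (k : ℕ) (f : G.edgeSet → ℕ) : Prop :=
  (∀ e, f e ≤ k) ∧ ∀ v, G.edgeLoad f v ≤ k

/-- `G` is `k`-`d`-critical: for every vertex `v` some `k`-matching has sum `k - d` at `v`
(written additively) and sum `k` at every other vertex. -/
def IsKDCritical {V : Type*} [Fintype V] [DecidableEq V] (G : SimpleGraph V) [DecidableRel G.Adj]
    (k d : ℕ) : Prop :=
  ∀ v, ∃ f : G.edgeSet → ℕ, G.IsKMatching k f ∧ G.edgeLoad f v + d = k ∧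
    ∀ u, u ≠ v → G.edgeLoad f u = k

/-- The complete graph `K_m`. -/
abbrev K (m : ℕ) : SimpleGraph (Fin m) := ⊤

/-- The graph `m K_1` consisting of `m` isolated vertices. -/
abbrev mK1 (m : ℕ) : SimpleGraph (Fin m) := ⊥

end SimpleGraph

/-! In every part the edge bound says that the complement of `G` has at most `n - 2` edges. Under
that hypothesis criticality is equivalent to the absence of a blocking pair, for every admissible
`k` and `d`.

A blocking pair `(I, S)` obstructs: all load on `I` is carried by edges into `S`, so `S` needs total
load at least `|I| k ≥ |S| k`, which fails once the deficient vertex is taken in `S`.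

Conversely, the required `k`-matching is a weighted sum of a matching and a permutation moving
points along edges, with the deficient vertex `v` missed by one of the two, according to the parity
of `n`. Hall's theorem gives the permutation, since a Hall violator yields a blocking pair. The
matching comes from the rotational one-factorization of a complete graph of even order: few missing
edges cannot meet all of its classes.

Finally, a blocking pair with `r` vertices outside `I ∪ S` forces `|I|(|I| - 1)/2 + r|I|` missing
edges. Comparing with `n - 2` leaves `|S| = 1`, which gives `K_1 ∨ (K_{n-2} + K_1)`, and a few small
pairs with `|S| ≥ 2`, which occur only for `n = 4, 5, 6, 8`. -/

namespace SimpleGraph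

/-! ### Blocking pairs as obstructions; building k-matchings from permutations -/

section Loads

/-- A disjoint pair `(I, S)` with `S` nonempty, `|S| ≤ |I|` and all neighbours of `I` in `S`. -/
structure IsBlockingPair {V : Type*} (G : SimpleGraph V) (I S : Finset V) : Prop where
  disjoint : Disjoint I S
  nonempty : S.Nonempty
  card_le : S.card ≤ I.card
  mem_of_adj : ∀ x ∈ I, ∀ y, G.Adj x y → y ∈ S

variable {V : Type*} [Fintype V] [DecidableEq V] (G : SimpleGraph V) [DecidableRel G.Adj]

/-- The load at `v` is a sum over the vertices `u` adjacent to `v`. -/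
lemma edgeLoad_eq_sum (f : G.edgeSet → ℕ) (v : V) :
    G.edgeLoad f v = ∑ u, if h : G.Adj v u then f ⟨s(v, u), h⟩ else 0 := by
  classical
  rw [← Finset.sum_subset (Finset.subset_univ (G.neighborFinset v))
    (fun u _ hu => dif_neg (by simpa using hu)), ← Finset.sum_attach, edgeLoad]
  symm
  refine Finset.sum_bij
    (fun u _ => (⟨s(v, u.1), (G.mem_neighborFinset v u.1).1 u.2⟩ : G.edgeSet)) ?_ ?_ ?_ ?_
  · intro u _
    simp
  · intro u _ u' _ h
    have h' : s(v, u.1) = s(v, u'.1) := congrArg Subtype.val h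
    exact Subtype.ext (Sym2.congr_right.1 h')
  · rintro ⟨e, he⟩ hv
    obtain ⟨u, rfl⟩ := Sym2.mem_iff_exists.1 (Finset.mem_filter.1 hv).2
    exact ⟨⟨u, (G.mem_neighborFinset v u).2 he⟩, Finset.mem_attach _ _, rfl⟩
  · intro u _
    rw [dif_pos ((G.mem_neighborFinset v u.1).1 u.2)]

variable {G}

lemma IsBlockingPair.not_isKDCritical {I S : Finset V} (h : G.IsBlockingPair I S) {k d : ℕ}
    (hd : 1 ≤ d) : ¬ G.IsKDCritical k d := by
  intro hc
  obtain ⟨v, hv⟩ := h.nonempty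
  obtain ⟨f, -, hfv, hfu⟩ := hc v
  have hI : ∑ x ∈ I, G.edgeLoad f x = I.card * k := by
    rw [Finset.sum_const_nat]
    intro x hx
    exact hfu x fun hxv => Finset.disjoint_left.1 h.disjoint hx (hxv ▸ hv)
  have hS : ∑ y ∈ S, G.edgeLoad f y + d = S.card * k := by
    rw [← Finset.add_sum_erase _ _ hv,
      Finset.sum_const_nat (m := k) (fun u hu => hfu u (Finset.ne_of_mem_erase hu)),
      Finset.card_erase_of_mem hv]
    obtain ⟨s, hs⟩ : ∃ s, S.card = s + 1 :=
      ⟨S.card - 1, (Nat.succ_pred_eq_of_pos (Finset.card_pos.2 ⟨v, hv⟩)).symm⟩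
    rw [hs, Nat.add_sub_cancel, add_mul, one_mul]
    omega
  -- Every edge at a vertex of `I` ends in `S`, so it is counted again on the right.
  have hle : ∑ x ∈ I, G.edgeLoad f x ≤ ∑ y ∈ S, G.edgeLoad f y := by
    simp only [edgeLoad_eq_sum]
    calc _ = ∑ x ∈ I, ∑ y ∈ S, (if h : G.Adj x y then f ⟨s(x, y), h⟩ else 0) := by
            refine Finset.sum_congr rfl fun x hx => ?_
            symm
            refine Finset.sum_subset (Finset.subset_univ _) fun y _ hy => dif_neg ?_
            exact fun hxy => hy (h.mem_of_adj x hx y hxy)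
      _ = ∑ y ∈ S, ∑ x ∈ I, (if h : G.Adj x y then f ⟨s(x, y), h⟩ else 0) := Finset.sum_comm
      _ ≤ _ := by
            refine Finset.sum_le_sum fun y _ => ?_
            refine le_trans (le_of_eq ?_) (Finset.sum_le_sum_of_subset (Finset.subset_univ I))
            refine Finset.sum_congr rfl fun x _ => ?_
            by_cases hxy : G.Adj x y
            · rw [dif_pos hxy, dif_pos hxy.symm]
              congr 2
              exact Sym2.eq_swap
            · rw [dif_neg hxy, dif_neg fun hyx => hxy hyx.symm]
  have := Nat.mul_le_mul_right k h.card_le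
  omega

/-- It suffices to find, for each vertex, a symmetric weight on ordered pairs. -/
lemma isKDCritical_of_weights {k d : ℕ}
    (h : ∀ v, ∃ w : V → V → ℕ, (∀ x y, w x y = w y x) ∧ (∀ x y, w x y ≠ 0 → G.Adj x y) ∧
      ∑ u, w v u + d = k ∧ ∀ x, x ≠ v → ∑ u, w x u = k) : G.IsKDCritical k d := by
  intro v
  obtain ⟨w, hsymm, hadj, hv, hx⟩ := h v
  have hload : ∀ x, G.edgeLoad (fun e => Sym2.lift ⟨w, hsymm⟩ e.1) x = ∑ u, w x u := by
    intro x
    rw [edgeLoad_eq_sum]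
    refine Finset.sum_congr rfl fun u _ => ?_
    by_cases hxu : G.Adj x u
    · rw [dif_pos hxu, Sym2.lift_mk]
    · rw [dif_neg hxu]
      by_contra hne
      exact hxu (hadj x u (Ne.symm hne))
  have hle : ∀ x, ∑ u, w x u ≤ k := by
    intro x
    by_cases hxv : x = v
    · subst hxv; omega
    · exact (hx x hxv).le
  refine ⟨_, ⟨?_, fun x => (hload x).le.trans (hle x)⟩, by rw [hload, hv],
    fun x hxv => by rw [hload, hx x hxv]⟩
  rintro ⟨e, he⟩
  induction e using Sym2.ind with
  | _ x y =>
    rw [Sym2.lift_mk]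
    exact (Finset.single_le_sum (f := w x) (fun _ _ => Nat.zero_le _)
      (Finset.mem_univ y)).trans (hle x)

/-- A permutation moving points along edges, together with an involution doing so, gives a
weight whose row sums count the moved points. -/
lemma exists_weight_of_perm (σ τ : Equiv.Perm V) (hσ : Function.Involutive σ)
    (hσG : ∀ x, σ x ≠ x → G.Adj x (σ x)) (hτG : ∀ x, τ x ≠ x → G.Adj x (τ x)) (a b : ℕ) :
    ∃ w : V → V → ℕ, (∀ x y, w x y = w y x) ∧ (∀ x y, w x y ≠ 0 → G.Adj x y) ∧
      ∀ x, ∑ u, w x u = (if σ x = x then 0 else a) + (if τ x = x then 0 else 2 * b) := by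
  have hσ' : ∀ x y, σ x = y ↔ σ y = x := fun x y =>
    ⟨fun h => h ▸ hσ x, fun h => h ▸ hσ y⟩
  -- Each `σ`-edge gets `a`; each arc `x → τ x` gets `b`, so a moved point collects `b` from its
  -- outgoing and `b` from its incoming arc. A 2-cycle of `τ` thus carries `2b` on its single edge.
  -- Zeroing the diagonal discards fixed points.
  refine ⟨fun x y => if x = y then 0 else
    ((if σ x = y then a else 0) + ((if τ x = y then b else 0) + (if τ y = x then b else 0))),
    ?_, ?_, ?_⟩
  · intro x y
    simp only [hσ' x y, eq_comm (a := x) (b := y)]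
    split_ifs <;> omega
  · intro x y hne
    by_cases hxy : x = y
    · simp [hxy] at hne
    by_contra hadj
    refine hne ?_
    have h1 : σ x ≠ y := fun h => hadj (h ▸ hσG x (h ▸ Ne.symm hxy))
    have h2 : τ x ≠ y := fun h => hadj (h ▸ hτG x (h ▸ Ne.symm hxy))
    have h3 : τ y ≠ x := fun h => hadj (h ▸ (hτG y (h ▸ hxy)).symm)
    simp [h1, h2, h3]
  · intro x
    have h1 : ∀ u, (if x = u then 0 else ((if σ x = u then a else 0) +
        ((if τ x = u then b else 0) + (if τ u = x then b else 0)))) =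
        (if σ x = u then (if σ x = x then 0 else a) else 0) +
        ((if τ x = u then (if τ x = x then 0 else b) else 0) +
          (if u = τ.symm x then (if τ x = x then 0 else b) else 0)) := by
      intro u
      have h4 : u = τ.symm x ↔ τ u = x := Equiv.eq_symm_apply τ
      by_cases hxu : x = u
      · subst hxu
        by_cases h5 : σ x = x <;> by_cases h6 : τ x = x <;> simp [h4, h5, h6]
      · rw [if_neg hxu]
        have h5 : σ x = u → σ x ≠ x := fun h h' => hxu (h' ▸ h)
        have h6 : τ x = u → τ x ≠ x := fun h h' => hxu (h' ▸ h)
        have h7 : τ u = x → τ x ≠ x := fun h h' => hxu (τ.injective (h'.trans h.symm))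
        simp only [h4]
        split_ifs <;> simp_all
    rw [Finset.sum_congr rfl fun u _ => h1 u, Finset.sum_add_distrib, Finset.sum_add_distrib,
      Finset.sum_ite_eq, Finset.sum_ite_eq, Finset.sum_ite_eq']
    simp only [Finset.mem_univ, if_true]
    split_ifs <;> omega

end Loads

end SimpleGraph

namespace SimpleGraph

/-! ### Perfect matchings avoiding few pairs, and intersecting families of pairs -/

section OneFactorization

/-- A class of the rotational one-factorization of the complete graph on `Option R`: the
reflection in `c`, with `c` itself matched to the extra point. -/
def reflectionMatching {R : Type*} [CommRing R] [DecidableEq R] (c : R) : Option R → Option R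
  | none => some c
  | some i => if i = c then none else some (2 * c - i)

variable {R : Type*} [CommRing R] [DecidableEq R]

lemma reflectionMatching_involutive (c : R) : Function.Involutive (reflectionMatching c) := by
  rintro (_ | i)
  · simp [reflectionMatching]
  · by_cases h : i = c
    · simp [reflectionMatching, h]
    · have h' : 2 * c - i ≠ c := fun h' => h (by linear_combination -h')
      simp [reflectionMatching, h, h']

lemma reflectionMatching_ne (h2 : IsUnit (2 : R)) (c : R) (x : Option R) :
    reflectionMatching c x ≠ x := by
  rcases x with _ | i
  · simp [reflectionMatching]
  · by_cases h : i = c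
    · simp [reflectionMatching, h]
    · simp only [reflectionMatching, h, if_false, ne_eq, Option.some.injEq]
      exact fun h' => h (h2.mul_left_cancel (by linear_combination -h'))

/-- This makes the classes for different `c` edge-disjoint, as the pigeonhole argument on classes
needs. -/
lemma reflectionMatching_injective (h2 : IsUnit (2 : R)) (x : Option R) :
    Function.Injective fun c : R => reflectionMatching c x := by
  intro c c' h
  rcases x with _ | i
  · simpa [reflectionMatching] using h
  · by_cases h1 : i = c <;> by_cases h3 : i = c' <;> simp [reflectionMatching, h1, h3] at h
    · exact h1.symm.trans h3
    · exact absurd (h1.trans h) h3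
    · exact absurd (h3.trans h) h1
    · exact h2.mul_left_cancel h

/-- Among `2m` points, a set of fewer than `2m - 1` pairs avoids some perfect matching; a set of
`2m - 1` pairs does so as well if it contains two disjoint pairs. -/
lemma exists_involutive_avoiding {U : Type*} [Fintype U] [DecidableEq U] (m : ℕ)
    (hU : Fintype.card U = 2 * m + 2) (F : Finset (Sym2 U)) (hF : F.card ≤ 2 * m + 1)
    (h : F.card = 2 * m + 1 → ∃ a b c d : U, [a, b, c, d].Nodup ∧ s(a, b) ∈ F ∧ s(c, d) ∈ F) :
    ∃ σ : Equiv.Perm U, Function.Involutive σ ∧ ∀ x, σ x ≠ x ∧ s(x, σ x) ∉ F := by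
  classical
  let Z := ZMod (2 * m + 1)
  have h2 : IsUnit (2 : Z) := by
    have : IsUnit ((2 : ℕ) : Z) := (ZMod.isUnit_iff_coprime 2 (2 * m + 1)).2 (by simp)
    simpa using this
  have hcard : Fintype.card U = Fintype.card (Option Z) := by
    rw [Fintype.card_option, ZMod.card, hU]
  -- In the tight case the labelling puts both disjoint pairs into the class of `0`, as `{∞, 0}` and
  -- `{1, -1}`, where `∞` is `none`; the symmetric group is 4-transitive. Then `F` wastes a pair and
  -- cannot meet all `2m + 1` classes.
  obtain ⟨e, he⟩ : ∃ e : U ≃ Option Z, F.card = 2 * m + 1 → ∃ p q p' q' : U, s(p, q) ∈ F ∧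
      s(p', q') ∈ F ∧ s(p, q) ≠ s(p', q') ∧ reflectionMatching (0 : Z) (e p) = e q ∧
      reflectionMatching (0 : Z) (e p') = e q' := by
    let e₀ := Fintype.equivOfCardEq hcard
    by_cases hF' : F.card = 2 * m + 1
    · obtain ⟨a, b, c, d, hnd, hab, hcd⟩ := h hF'
      have hm : 1 ≤ m := by
        have := hnd.length_le_card
        simp only [List.length_cons, List.length_nil, hU] at this
        omega
      have : Fact (2 < 2 * m + 1) := ⟨by omega⟩
      have : Fact (1 < 2 * m + 1) := ⟨by omega⟩
      have h10 : (1 : Z) ≠ 0 := one_ne_zero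
      have h11 : (-1 : Z) ≠ 1 := ZMod.neg_one_ne_one
      simp only [List.nodup_cons, List.mem_cons, List.not_mem_nil, or_false, not_or,
        List.nodup_nil, not_false_eq_true, and_true] at hnd
      obtain ⟨⟨n1, n2, n3⟩, ⟨n4, n5⟩, n6⟩ := hnd
      let u : Fin 4 ↪ Option Z := ⟨![e₀ a, e₀ b, e₀ c, e₀ d], by
        intro i j
        fin_cases i <;> fin_cases j <;> 
          simp [n1, n2, n3, n4, n5, n6, Ne.symm n1, Ne.symm n2, Ne.symm n3, Ne.symm n4,
            Ne.symm n5, Ne.symm n6]⟩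
      let t : Fin 4 ↪ Option Z := ⟨![none, some 0, some 1, some (-1)], by
        intro i j
        fin_cases i <;> fin_cases j <;> simp [h10, h11, h10.symm, h11.symm]⟩
      obtain ⟨g, hg⟩ := (Equiv.Perm.isMultiplyPretransitive (Option Z) 4).exists_smul_eq u t
      have hg' : ∀ i, g (u i) = t i := fun i => by
        rw [← hg]; rfl
      refine ⟨e₀.trans g, fun _ => ⟨a, b, c, d, hab, hcd, ?_, ?_, ?_⟩⟩
      · simp [n2, n3]
      · have ha : g (e₀ a) = none := hg' 0
        have hb : g (e₀ b) = some 0 := hg' 1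
        simp [ha, hb, reflectionMatching]
      · have hc : g (e₀ c) = some 1 := hg' 2
        have hd : g (e₀ d) = some (-1) := hg' 3
        simp [hc, hd, reflectionMatching, h10]
    · exact ⟨e₀, fun h => absurd h hF'⟩
  let τ : Z → U → U := fun c x => e.symm (reflectionMatching c (e x))
  have hτ : ∀ c, Function.Involutive (τ c) := fun c x => by
    simp [τ, reflectionMatching_involutive c (e x)]
  have hτne : ∀ c x, τ c x ≠ x := fun c x hx =>
    reflectionMatching_ne h2 c (e x) (by simpa [τ, Equiv.symm_apply_eq] using hx)
  have hτinj : ∀ c c' x x', s(x, τ c x) = s(x', τ c' x') → c = c' := by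
    intro c c' x x' hx
    have : τ c x = τ c' x := by
      rcases Sym2.eq_iff.1 hx with ⟨rfl, h'⟩ | ⟨h1, h'⟩
      · exact h'
      · rw [h', h1, hτ c' x']
    exact reflectionMatching_injective h2 (e x) (e.symm.injective this)
  by_contra hcon
  have hmeet : ∀ c, ∃ x, s(x, τ c x) ∈ F := by
    intro c
    by_contra hc
    push Not at hc
    exact hcon ⟨(hτ c).toPerm, hτ c, fun x => ⟨hτne c x, hc x⟩⟩
  choose x hx using hmeet
  let φ : Z → Sym2 U := fun c => s(x c, τ c (x c))
  have hφ : Function.Injective φ := fun c c' hc => hτinj _ _ _ _ hc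
  have himage : Finset.univ.image φ ⊆ F := by
    intro y hy
    obtain ⟨c, -, rfl⟩ := Finset.mem_image.1 hy
    exact hx c
  have hcardφ : (Finset.univ.image φ).card = 2 * m + 1 := by
    rw [Finset.card_image_of_injective _ hφ, Finset.card_univ, ZMod.card]
  -- If every class is met, `F` is exactly one pair per class, against the two pairs in the class of
  -- `0`.
  have heq := Finset.eq_of_subset_of_card_le himage (hF.trans hcardφ.ge)
  obtain ⟨p, q, p', q', hp, hp', hne, hq, hq'⟩ := he (heq ▸ hcardφ)
  have key : ∀ p q, s(p, q) ∈ F → reflectionMatching (0 : Z) (e p) = e q → s(p, q) = φ 0 := by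
    intro p q hpF hpq
    rw [← heq] at hpF
    obtain ⟨c, -, hc⟩ := Finset.mem_image.1 hpF
    have hq : q = τ 0 p := by simp [τ, hpq]
    have : c = 0 := hτinj _ _ (x c) p (by rw [← hq]; exact hc)
    rw [← hc, this]
  exact hne ((key p q hp hq).trans (key p' q' hp' hq').symm)

/-- A nonempty intersecting family of pairs is a star or is contained in a triangle. -/
lemma star_or_triangle {U : Type*} [DecidableEq U] (F : Finset (Sym2 U)) (hne : F.Nonempty)
    (hdiag : ∀ e ∈ F, ¬ e.IsDiag)
    (hF : ¬ ∃ a b c d : U, [a, b, c, d].Nodup ∧ s(a, b) ∈ F ∧ s(c, d) ∈ F) :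
    (∃ a, ∀ e ∈ F, a ∈ e) ∨
      ∃ a b c, a ≠ b ∧ a ≠ c ∧ b ≠ c ∧ F ⊆ {s(a, b), s(a, c), s(b, c)} := by
  have hint : ∀ a b c d, s(a, b) ∈ F → s(c, d) ∈ F → a = c ∨ a = d ∨ b = c ∨ b = d := by
    intro a b c d h1 h2
    by_contra hcon
    have n1 := hdiag _ h1
    have n2 := hdiag _ h2
    rw [Sym2.mk_isDiag_iff] at n1 n2
    exact hF ⟨a, b, c, d, by simp; tauto, h1, h2⟩
  by_contra hcon
  push Not at hcon
  obtain ⟨hstar, htri⟩ := hcon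
  obtain ⟨e, he⟩ := hne
  induction e using Sym2.ind with
  | _ a b =>
  have hab : a ≠ b := by simpa using hdiag _ he
  obtain ⟨e₁, he₁, ha₁⟩ := hstar a
  obtain ⟨e₂, he₂, hb₂⟩ := hstar b
  have hb : b ∈ e₁ := by
    induction e₁ using Sym2.ind with
    | _ p q =>
      have := hint _ _ _ _ he he₁
      simp only [Sym2.mem_iff] at *
      tauto
  obtain ⟨c, rfl⟩ := Sym2.mem_iff_exists.1 hb
  have hbc : b ≠ c := by simpa using hdiag _ he₁
  have hac : a ≠ c := fun h => ha₁ (by simp [h])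
  have hac' : s(a, c) ∈ F := by
    have hae : a ∈ e₂ := by
      induction e₂ using Sym2.ind with
      | _ p q =>
        have := hint _ _ _ _ he he₂
        simp only [Sym2.mem_iff] at *
        tauto
    obtain ⟨c', rfl⟩ := Sym2.mem_iff_exists.1 hae
    have := hint _ _ _ _ he₁ he₂
    simp only [Sym2.mem_iff, not_or] at hb₂
    have : c = c' := by tauto
    rwa [this]
  refine htri a b c hab hac hbc fun e hef => ?_
  induction e using Sym2.ind with
  | _ p q =>
    have h1 := hint _ _ _ _ he hef
    have h2 := hint _ _ _ _ he₁ hef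
    have h3 := hint _ _ _ _ hac' hef
    simp only [Finset.mem_insert, Finset.mem_singleton, Sym2.eq_iff]
    grind

end OneFactorization

end SimpleGraph

namespace SimpleGraph

/-! ### Criticality in the absence of blocking pairs -/

section Sufficiency

variable {V : Type*} [Fintype V] [DecidableEq V] {G : SimpleGraph V} [DecidableRel G.Adj]

/-- Without blocking pairs, Hall's theorem yields a permutation along edges which fixes only the
points of a given set of size at most one. -/
lemma exists_perm_adj (hb : ∀ I S, ¬ G.IsBlockingPair I S) (X : Finset V) (hX : X.card ≤ 1)
    (hiso : X = ∅ → ∀ x, ∃ y, G.Adj x y) :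
    ∃ τ : Equiv.Perm V, ∀ x, (x ∈ X → τ x = x) ∧ (x ∉ X → G.Adj x (τ x)) := by
  let N : Finset V → Finset V := fun A => A.biUnion fun x => G.neighborFinset x
  -- For a violator `A`, removing the common part of `A` and `N A` from both keeps the deficiency of
  -- at least one. This leaves room to add the at most one point of `X` to the neighbour side,
  -- giving a blocking pair.
  have hall : ∀ A, Disjoint A X → A.card ≤ (N A \ X).card := by
    intro A hA
    by_contra hlt
    push Not at hlt
    have hadj : ∀ x ∈ A \ (N A \ X), ∀ y, G.Adj x y → y ∈ ((N A \ X) \ A) ∪ X := by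
      intro x hx y hxy
      rw [Finset.mem_sdiff] at hx
      have hyN : y ∈ N A := Finset.mem_biUnion.2 ⟨x, hx.1, by simpa using hxy⟩
      by_cases hyX : y ∈ X
      · exact Finset.mem_union_right _ hyX
      · refine Finset.mem_union_left _ (Finset.mem_sdiff.2 ⟨Finset.mem_sdiff.2 ⟨hyN, hyX⟩, ?_⟩)
        intro hyA
        refine hx.2 (Finset.mem_sdiff.2 ⟨?_, Finset.disjoint_left.1 hA hx.1⟩)
        exact Finset.mem_biUnion.2 ⟨y, hyA, by simpa using hxy.symm⟩
    have h1 := Finset.card_sdiff_add_card_inter A (N A \ X)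
    have h2 := Finset.card_sdiff_add_card_inter (N A \ X) A
    rw [Finset.inter_comm] at h2
    have h3 := Finset.card_union_le ((N A \ X) \ A) X
    refine hb (A \ (N A \ X)) (((N A \ X) \ A) ∪ X) ⟨?_, ?_, by omega, hadj⟩
    · rw [Finset.disjoint_left]
      intro x hx hx'
      rw [Finset.mem_sdiff] at hx
      rcases Finset.mem_union.1 hx' with h | h
      · exact (Finset.mem_sdiff.1 h).2 hx.1
      · exact Finset.disjoint_left.1 hA hx.1 h
    · rcases X.eq_empty_or_nonempty with hX0 | hX0
      · obtain ⟨x, hx⟩ : (A \ (N A \ X)).Nonempty := Finset.card_pos.1 (by omega)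
        obtain ⟨y, hy⟩ := hiso hX0 x
        exact ⟨y, hadj x hx y hy⟩
      · exact hX0.mono Finset.subset_union_right
  obtain ⟨f, hf, hft⟩ := (Finset.all_card_le_biUnion_card_iff_exists_injective
    fun x => if x ∈ X then {x} else G.neighborFinset x \ X).1 (by
      intro A
      have hsub : (A ∩ X) ∪ (N (A \ X) \ X) ⊆
          A.biUnion fun x => if x ∈ X then {x} else G.neighborFinset x \ X := by
        intro y hy
        rw [Finset.mem_biUnion]
        rcases Finset.mem_union.1 hy with h | h
        · rw [Finset.mem_inter] at h
          exact ⟨y, h.1, by simp [h.2]⟩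
        · rw [Finset.mem_sdiff, Finset.mem_biUnion] at h
          obtain ⟨⟨x, hx, hxy⟩, hyX⟩ := h
          rw [Finset.mem_sdiff] at hx
          exact ⟨x, hx.1, by rw [if_neg hx.2]; exact Finset.mem_sdiff.2 ⟨hxy, hyX⟩⟩
      refine le_trans ?_ (Finset.card_le_card hsub)
      rw [Finset.card_union_of_disjoint]
      · have := hall (A \ X) Finset.sdiff_disjoint
        have := Finset.card_sdiff_add_card_inter A X
        omega
      · exact Finset.disjoint_left.2 fun y hy hy' =>
          (Finset.mem_sdiff.1 hy').2 (Finset.mem_inter.1 hy).2)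
  refine ⟨Equiv.ofBijective f (Finite.injective_iff_bijective.1 hf), fun x => ⟨?_, ?_⟩⟩
  · intro hx
    simpa [hx] using hft x
  · intro hx
    have := hft x
    rw [if_neg hx, Finset.mem_sdiff, mem_neighborFinset] at this
    exact this.1

/-- A graph of even order missing at most `|V| - 2` edges has a perfect matching. -/
lemma exists_involutive_adj_of_even (hpos : 0 < Fintype.card V) (hn : Even (Fintype.card V))
    (hH : Gᶜ.edgeFinset.card + 2 ≤ Fintype.card V) :
    ∃ σ : Equiv.Perm V, Function.Involutive σ ∧ ∀ x, G.Adj x (σ x) := by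
  obtain ⟨m, hm⟩ := hn
  obtain ⟨σ, hσ, h⟩ := exists_involutive_avoiding (U := V) (m - 1) (by omega) Gᶜ.edgeFinset
    (by omega) (by omega)
  refine ⟨σ, hσ, fun x => ?_⟩
  have hx := h x
  by_contra hadj
  exact hx.2 (by simpa using ⟨(hx.1).symm, hadj⟩)

/-- A graph of odd order missing at most `|V| - 2` edges and without blocking pairs has, for each
vertex `v`, a matching covering exactly the other vertices. -/
lemma exists_involutive_adj_of_odd (hb : ∀ I S, ¬ G.IsBlockingPair I S)
    (h3 : 3 ≤ Fintype.card V) (hn : Odd (Fintype.card V))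
    (hH : Gᶜ.edgeFinset.card + 2 ≤ Fintype.card V) (v : V) :
    ∃ σ : Equiv.Perm V, Function.Involutive σ ∧ σ v = v ∧ ∀ x, x ≠ v → G.Adj x (σ x) := by
  obtain ⟨m, hm⟩ : ∃ m, Fintype.card V = 2 * m + 3 := by
    obtain ⟨m, hm⟩ := hn
    exact ⟨m - 1, by omega⟩
  have hU : Fintype.card {x // x ≠ v} = 2 * m + 2 := by
    rw [Fintype.card_subtype_compl, Fintype.card_subtype_eq]
    omega
  let F : Finset (Sym2 {x // x ≠ v}) :=
    Finset.univ.filter fun e => e.map Subtype.val ∈ Gᶜ.edgeFinset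
  have hmem : ∀ a b : {x // x ≠ v}, s(a, b) ∈ F ↔ a ≠ b ∧ ¬ G.Adj a b := by
    intro a b
    simp [F, Subtype.ext_iff]
  have hF : F.card ≤ 2 * m + 1 := by
    have : F.card ≤ Gᶜ.edgeFinset.card :=
      Finset.card_le_card_of_injOn (Sym2.map Subtype.val) (fun e he => (Finset.mem_filter.1 he).2)
        ((Sym2.map.injective Subtype.val_injective).injOn)
    omega
  -- In the tight case without disjoint missing pairs, a star makes its centre `a` adjacent to at
  -- most `v`, so `({a}, {v})` blocks. A triangle forces `n = 5`, and its independent triple blocks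
  -- together with the other two vertices.
  obtain ⟨σ, hσ, h⟩ := exists_involutive_avoiding m hU F hF (by
    intro hcard
    by_contra hcon
    rcases star_or_triangle F (Finset.card_pos.1 (by omega)) (by
        intro e
        induction e using Sym2.ind with
        | _ a b =>
          rw [hmem, Sym2.mk_isDiag_iff]
          exact fun h => h.1) hcon with ⟨a, ha⟩ | ⟨a, b, c, hab, hac, hbc, hsub⟩
    · have hsub : F ⊆ (Finset.univ.erase a).image fun b => s(a, b) := by
        intro e he
        obtain ⟨b, rfl⟩ := Sym2.mem_iff_exists.1 (ha e he)
        refine Finset.mem_image.2 ⟨b, Finset.mem_erase.2 ⟨?_, Finset.mem_univ _⟩, rfl⟩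
        exact ((hmem a b).1 he).1.symm
      have heq := Finset.eq_of_subset_of_card_le hsub (by
        refine Finset.card_image_le.trans ?_
        rw [Finset.card_erase_of_mem (Finset.mem_univ a), Finset.card_univ, hU, hcard]
        omega)
      refine hb {a.1} {v} ⟨by simpa using a.2, by simp, by simp, ?_⟩
      intro x hx y hxy
      rw [Finset.mem_singleton] at hx ⊢
      subst hx
      by_contra hyv
      have : s(a, ⟨y, hyv⟩) ∈ F := by
        rw [heq]
        exact Finset.mem_image.2 ⟨⟨y, hyv⟩, Finset.mem_erase.2
          ⟨fun h => hxy.ne (congrArg Subtype.val h).symm, Finset.mem_univ _⟩, rfl⟩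
      exact ((hmem _ _).1 this).2 hxy
    · have hle := hcard ▸ Finset.card_le_card hsub
      have hle3 : ({s(a, b), s(a, c), s(b, c)} : Finset (Sym2 {x // x ≠ v})).card ≤ 3 :=
        Finset.card_le_three
      have h3U : ({a, b, c} : Finset {x // x ≠ v}).card = 3 := by
        rw [Finset.card_eq_three]
        exact ⟨a, b, c, hab, hac, hbc, rfl⟩
      have hle' := h3U ▸ Finset.card_le_univ ({a, b, c} : Finset {x // x ≠ v})
      have hm1 : m = 1 := by omega
      have heq := Finset.eq_of_subset_of_card_le hsub (by omega)
      have hI : (({a, b, c} : Finset {x // x ≠ v}).map (Function.Embedding.subtype _)).card = 3 := by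
        rw [Finset.card_map, h3U]
      refine hb (({a, b, c} : Finset {x // x ≠ v}).map (Function.Embedding.subtype _))
        (({a, b, c} : Finset {x // x ≠ v}).map (Function.Embedding.subtype _))ᶜ
        ⟨disjoint_compl_right, ?_, ?_, ?_⟩
      · rw [← Finset.card_pos, Finset.card_compl]
        omega
      · rw [Finset.card_compl]
        omega
      · intro x hx y hxy
        rw [Finset.mem_compl]
        intro hy
        obtain ⟨x', hx', rfl⟩ := Finset.mem_map.1 hx
        obtain ⟨y', hy', rfl⟩ := Finset.mem_map.1 hy
        have hne : x' ≠ y' := fun h => hxy.ne (congrArg Subtype.val h)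
        have : s(x', y') ∈ F := by
          rw [heq]
          simp only [Finset.mem_insert, Finset.mem_singleton, Sym2.eq_iff] at hx' hy' ⊢
          grind
        exact ((hmem _ _).1 this).2 hxy)
  have hval : ∀ x (hx : x ≠ v), Equiv.Perm.ofSubtype σ x = σ ⟨x, hx⟩ := fun x hx =>
    Equiv.Perm.ofSubtype_apply_of_mem σ hx
  have hv : Equiv.Perm.ofSubtype σ v = v :=
    Equiv.Perm.ofSubtype_apply_of_not_mem σ (by simp)
  refine ⟨Equiv.Perm.ofSubtype σ, ?_, hv, ?_⟩
  · intro x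
    by_cases hx : x = v
    · rw [hx, hv, hv]
    · rw [hval x hx, hval _ (σ ⟨x, hx⟩).2, hσ]
  · intro x hx
    rw [hval x hx]
    obtain ⟨h1, h2⟩ := h ⟨x, hx⟩
    by_contra hadj
    exact h2 ((hmem _ _).2 ⟨h1.symm, hadj⟩)

/-- A graph missing at most `|V| - 2` edges is critical if it has no blocking pair. -/
theorem isKDCritical_of_forall_not_isBlockingPair (hb : ∀ I S, ¬ G.IsBlockingPair I S) {k d : ℕ}
    (h3 : 3 ≤ Fintype.card V) (hk : Odd k) (hdk : d < k) (hd : Fintype.card V ≡ d [MOD 2])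
    (hH : Gᶜ.edgeFinset.card + 2 ≤ Fintype.card V) : G.IsKDCritical k d := by
  have hiso : ∀ x, ∃ y, G.Adj x y := by
    intro x
    by_contra hx
    push Not at hx
    have h1 := G.degree_compl x
    have h0 : G.degree x = 0 := by
      rw [← card_neighborFinset_eq_degree, Finset.card_eq_zero, Finset.eq_empty_iff_forall_notMem]
      simpa using hx
    have h2 := Gᶜ.degree_le_card_edgeFinset x
    omega
  refine isKDCritical_of_weights fun v => ?_
  have hk' := Nat.odd_iff.1 hk
  rw [Nat.ModEq] at hd
  rcases Nat.even_or_odd (Fintype.card V) with hn | hn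
  · have hn' := Nat.even_iff.1 hn
    obtain ⟨σ, hσ, hσG⟩ := exists_involutive_adj_of_even (G := G) (by omega) hn hH
    obtain ⟨τ, hτ⟩ := exists_perm_adj hb {v} (by simp) (by simp)
    simp only [Finset.mem_singleton] at hτ
    -- Here `d` is even and `τ` fixes `v`: the load is `k - d` at `v` and `(k - d) + 2(d/2) = k`
    -- elsewhere.
    obtain ⟨w, hw, hwG, hsum⟩ := exists_weight_of_perm (G := G) σ τ hσ (fun x _ => hσG x)
      (fun x hx => (hτ x).2 fun h => hx ((hτ x).1 h)) (k - d) (d / 2)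
    refine ⟨w, hw, hwG, ?_, fun x hx => ?_⟩
    · rw [hsum, if_neg (hσG v).ne', if_pos ((hτ v).1 rfl)]
      omega
    · rw [hsum, if_neg (hσG x).ne', if_neg ((hτ x).2 hx).ne']
      omega
  · have hn' := Nat.odd_iff.1 hn
    obtain ⟨σ, hσ, hσv, hσG⟩ := exists_involutive_adj_of_odd hb h3 hn hH v
    obtain ⟨τ, hτ⟩ := exists_perm_adj hb ∅ (by simp) (fun _ => hiso)
    have hτ' : ∀ x, G.Adj x (τ x) := fun x => (hτ x).2 (by simp)
    -- Here `k - d` is even and `σ` misses `v`: the load is `k - d` at `v` and `d + (k - d) = k`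
    -- elsewhere.
    obtain ⟨w, hw, hwG, hsum⟩ := exists_weight_of_perm (G := G) σ τ hσ
      (fun x hx => hσG x fun h => hx (h ▸ hσv)) (fun x _ => hτ' x) d ((k - d) / 2)
    refine ⟨w, hw, hwG, ?_, fun x hx => ?_⟩
    · rw [hsum, if_pos hσv, if_neg (hτ' v).ne']
      omega
    · rw [hsum, if_neg (hσG x hx).ne', if_neg (hτ' x).ne']
      omega

end Sufficiency

end SimpleGraph

namespace SimpleGraph

/-! ### Recognising the exceptional graphs -/

section Isomorphisms

lemma IsBlockingPair.map {V : Type*} {G : SimpleGraph V} {W : Type*} {H : SimpleGraph W} {I S : Finset W}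
    (h : H.IsBlockingPair I S) (φ : H ≃g G) :
    G.IsBlockingPair (I.map φ.toEquiv.toEmbedding) (S.map φ.toEquiv.toEmbedding) where
  disjoint := (Finset.disjoint_map _).2 h.disjoint
  nonempty := h.nonempty.map
  card_le := by simpa using h.card_le
  mem_of_adj := by
    intro x hx y hxy
    obtain ⟨x, hxI, rfl⟩ := Finset.mem_map.1 hx
    obtain ⟨y, rfl⟩ := φ.surjective y
    exact Finset.mem_map_of_mem _ (h.mem_of_adj x hxI y (φ.map_rel_iff.1 hxy))

lemma isBlockingPair_join_mK1 {m l : ℕ} (hm : 1 ≤ m) (hl : m ≤ l) :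
    ((K m).join (mK1 l)).IsBlockingPair (Finset.univ.map Function.Embedding.inr)
      (Finset.univ.map Function.Embedding.inl) where
  disjoint := by
    rw [Finset.disjoint_left]
    simp
  nonempty := (Finset.univ_nonempty_iff.2 ⟨⟨0, hm⟩⟩).map
  card_le := by simpa using hl
  mem_of_adj := by
    intro x hx y hxy
    obtain ⟨i, -, rfl⟩ := Finset.mem_map.1 hx
    rcases y with y | y
    · simp
    · simp [join] at hxy

lemma isBlockingPair_join_K_sum_K_one (m : ℕ) :
    ((K 1).join (K m ⊕g K 1)).IsBlockingPair {Sum.inr (Sum.inr 0)} {Sum.inl 0} where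
  disjoint := by simp
  nonempty := by simp
  card_le := by simp
  mem_of_adj := by
    intro x hx y hxy
    rw [Finset.mem_singleton] at hx
    subst hx
    rcases y with y | y | y
    · simp [Subsingleton.elim y 0]
    · simp [join] at hxy
    · simp [join, Subsingleton.elim y 0] at hxy

variable {V : Type*} [Fintype V] [DecidableEq V] {G : SimpleGraph V}

lemma nonempty_iso_join_mK1 {m l : ℕ} (T : Finset V) (hT : T.card = l) (hT' : Tᶜ.card = m)
    (h : ∀ x y, G.Adj x y ↔ x ≠ y ∧ ¬ (x ∈ T ∧ y ∈ T)) : Nonempty (G ≃g (K m).join (mK1 l)) := by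
  let e₁ := Tᶜ.equivFinOfCardEq hT'
  let e₂ := T.equivFinOfCardEq hT
  let g : Fin m ⊕ Fin l → V := Sum.elim (fun i => e₁.symm i) (fun i => e₂.symm i)
  have h₁ : ∀ i, (e₁.symm i : V) ∉ T := fun i => Finset.mem_compl.1 (e₁.symm i).2
  have h₂ : ∀ i, (e₂.symm i : V) ∈ T := fun i => (e₂.symm i).2
  have hg : Function.Injective g := by
    rintro (i | i) (j | j) hij
    · simpa [g, Subtype.ext_iff.symm] using hij
    · exact absurd (Set.mem_of_eq_of_mem hij (h₂ j)) (h₁ i)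
    · exact absurd (Set.mem_of_eq_of_mem hij.symm (h₂ i)) (h₁ j)
    · simpa [g, Subtype.ext_iff.symm] using hij
  have hbij : Function.Bijective g := (Fintype.bijective_iff_injective_and_card g).2 ⟨hg, by
    rw [Fintype.card_sum, Fintype.card_fin, Fintype.card_fin, ← hT, ← hT', add_comm,
      Finset.card_add_card_compl]⟩
  refine ⟨RelIso.symm ⟨Equiv.ofBijective g hbij, ?_⟩⟩
  intro p q
  change G.Adj (g p) (g q) ↔ _
  rw [h, hg.ne_iff]
  rcases p with p | p <;> rcases q with q | q <;> simp [g, join, h₁, h₂]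

lemma nonempty_iso_join_K_sum_K_one {n : ℕ} (hn : Fintype.card V = n) {z w : V} (hzw : z ≠ w)
    (h : ∀ x y, G.Adj x y ↔ x ≠ y ∧ ¬ ((x = z ∧ y ≠ w) ∨ (y = z ∧ x ≠ w))) :
    Nonempty (G ≃g (K 1).join (K (n - 2) ⊕g K 1)) := by
  have hT : (({z, w} : Finset V)ᶜ).card = n - 2 := by
    rw [Finset.card_compl, Finset.card_pair hzw, hn]
  let e := (({z, w} : Finset V)ᶜ).equivFinOfCardEq hT
  let g : Fin 1 ⊕ (Fin (n - 2) ⊕ Fin 1) → V :=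
    Sum.elim (fun _ => w) (Sum.elim (fun i => e.symm i) fun _ => z)
  have he : ∀ i, (e.symm i : V) ≠ z ∧ (e.symm i : V) ≠ w := fun i => by
    simpa using (e.symm i).2
  have hg : Function.Injective g := by
    rintro (i | i | i) (j | j | j) hij
    · exact congrArg _ (Subsingleton.elim _ _)
    · exact absurd hij.symm (he j).2
    · exact absurd hij.symm hzw
    · exact absurd hij (he i).2
    · simpa [g, Subtype.ext_iff.symm] using hij
    · exact absurd hij (he i).1
    · exact absurd hij hzw
    · exact absurd hij.symm (he j).1
    · exact congrArg _ (congrArg _ (Subsingleton.elim _ _))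
  have h2 : 2 ≤ n := by
    rw [← hn, ← Finset.card_pair hzw]
    exact Finset.card_le_univ _
  have hbij : Function.Bijective g := (Fintype.bijective_iff_injective_and_card g).2 ⟨hg, by
    simp only [Fintype.card_sum, Fintype.card_fin]
    omega⟩
  refine ⟨RelIso.symm ⟨Equiv.ofBijective g hbij, ?_⟩⟩
  intro p q
  change G.Adj (g p) (g q) ↔ _
  rw [h, hg.ne_iff]
  have hz : ∀ i, (e.symm i : V) ≠ z := fun i => (he i).1
  have hw : ∀ i, (e.symm i : V) ≠ w := fun i => (he i).2
  rcases p with p | p | p <;> rcases q with q | q | q <;>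
    simp [g, join, hz, hw, hzw, hzw.symm, eq_iff_true_of_subsingleton]

end Isomorphisms

/-! ### Counting the non-edges forced by a blocking pair -/

section Extremal

/-- The non-edges forced by a blocking pair `(I, S)`. -/
def blockedGraph {V : Type*} (I S : Finset V) : SimpleGraph V where
  Adj x y := x ≠ y ∧ ((x ∈ I ∧ y ∉ S) ∨ (y ∈ I ∧ x ∉ S))
  symm := ⟨fun _ _ h => ⟨h.1.symm, h.2.symm⟩⟩
  loopless := ⟨fun _ h => h.1 rfl⟩

lemma blockedGraph_adj {V : Type*} {I S : Finset V} {x y : V} :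
    (blockedGraph I S).Adj x y ↔ x ≠ y ∧ ((x ∈ I ∧ y ∉ S) ∨ (y ∈ I ∧ x ∉ S)) :=
  Iff.rfl

instance {V : Type*} [DecidableEq V] (I S : Finset V) : DecidableRel (blockedGraph I S).Adj := fun x y =>
  inferInstanceAs (Decidable (x ≠ y ∧ ((x ∈ I ∧ y ∉ S) ∨ (y ∈ I ∧ x ∉ S))))

lemma IsBlockingPair.blockedGraph_le {V : Type*} {G : SimpleGraph V} {I S : Finset V}
    (h : G.IsBlockingPair I S) : blockedGraph I S ≤ Gᶜ := by
  intro x y hxy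
  rw [compl_adj]
  refine ⟨hxy.1, fun hadj => ?_⟩
  rcases hxy.2 with ⟨h1, h2⟩ | ⟨h1, h2⟩
  · exact h2 (h.mem_of_adj _ h1 _ hadj)
  · exact h2 (h.mem_of_adj _ h1 _ hadj.symm)

variable {V : Type*} [Fintype V] [DecidableEq V] {G : SimpleGraph V} [DecidableRel G.Adj]

lemma card_edgeFinset_add_card_edgeFinset_compl (G : SimpleGraph V) [DecidableRel G.Adj] :
    G.edgeFinset.card + Gᶜ.edgeFinset.card = (Fintype.card V).choose 2 := by
  rw [← Finset.card_union_of_disjoint (disjoint_edgeFinset.2 disjoint_compl_right),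
    ← edgeFinset_sup, ← card_edgeFinset_top_eq_card_choose_two]
  congr 1
  ext e
  simp only [mem_edgeFinset, sup_compl_eq_top]

lemma two_mul_card_edgeFinset_blockedGraph {I S : Finset V} (h : Disjoint I S) {r : ℕ}
    (hr : I.card + S.card + r = Fintype.card V) :
    2 * (blockedGraph I S).edgeFinset.card = I.card * (I.card + r - 1) + r * I.card := by
  have hI : ∀ x ∈ I, (blockedGraph I S).degree x = I.card + r - 1 := by
    intro x hx
    have : (blockedGraph I S).neighborFinset x = Sᶜ.erase x := by
      ext y
      have hxS := Finset.disjoint_left.1 h hx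
      have hyS : y ∈ I → y ∉ S := fun hy => Finset.disjoint_left.1 h hy
      simp only [mem_neighborFinset, blockedGraph_adj, Finset.mem_erase, Finset.mem_compl]
      grind
    rw [← card_neighborFinset_eq_degree, this, Finset.card_erase_of_mem
      (Finset.mem_compl.2 (Finset.disjoint_left.1 h hx)), Finset.card_compl]
    omega
  have hS : ∀ x ∈ S, (blockedGraph I S).degree x = 0 := by
    intro x hx
    rw [← card_neighborFinset_eq_degree, Finset.card_eq_zero, Finset.eq_empty_iff_forall_notMem]
    intro y
    have hxI := Finset.disjoint_right.1 h hx
    simp only [mem_neighborFinset, blockedGraph_adj]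
    tauto
  have hR : ∀ x ∈ (I ∪ S)ᶜ, (blockedGraph I S).degree x = I.card := by
    intro x hx
    rw [Finset.mem_compl, Finset.mem_union, not_or] at hx
    rw [← card_neighborFinset_eq_degree]
    congr 1
    ext y
    simp only [mem_neighborFinset, blockedGraph_adj]
    grind
  rw [← sum_degrees_eq_twice_card_edges, ← Finset.sum_add_sum_compl (I ∪ S),
    Finset.sum_union h, Finset.sum_const_nat hI, Finset.sum_const_nat hS,
    Finset.sum_const_nat hR, Finset.card_compl, Finset.card_union_of_disjoint h]
  have : Fintype.card V - (I.card + S.card) = r := by omega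
  rw [this]
  omega

lemma IsBlockingPair.two_mul_card_le {I S : Finset V} (h : G.IsBlockingPair I S) {r : ℕ}
    (hr : I.card + S.card + r = Fintype.card V) :
    I.card * (I.card + r - 1) + r * I.card ≤ 2 * Gᶜ.edgeFinset.card := by
  rw [← two_mul_card_edgeFinset_blockedGraph h.disjoint hr]
  exact Nat.mul_le_mul_left 2 (Finset.card_le_card (edgeFinset_mono h.blockedGraph_le))

/-- Equality in the count leaves only the forced non-edges, so the pair determines `G`. -/
lemma IsBlockingPair.adj_iff {I S : Finset V} (h : G.IsBlockingPair I S) {r : ℕ}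
    (hr : I.card + S.card + r = Fintype.card V)
    (hle : 2 * Gᶜ.edgeFinset.card ≤ I.card * (I.card + r - 1) + r * I.card) (x y : V) :
    G.Adj x y ↔ x ≠ y ∧ ¬ ((x ∈ I ∧ y ∉ S) ∨ (y ∈ I ∧ x ∉ S)) := by
  rw [← two_mul_card_edgeFinset_blockedGraph h.disjoint hr] at hle
  have heq := Finset.eq_of_subset_of_card_le (edgeFinset_mono h.blockedGraph_le) (by omega)
  have hxy : Gᶜ.Adj x y ↔ (blockedGraph I S).Adj x y := by
    rw [← mem_edgeSet, ← mem_edgeSet, ← mem_edgeFinset, ← mem_edgeFinset, heq]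
  rw [compl_adj] at hxy
  rw [blockedGraph_adj] at hxy
  have : G.Adj x y → x ≠ y := fun h => h.ne
  tauto

lemma IsBlockingPair.nonempty_iso_of_card_eq_one {I S : Finset V} (h : G.IsBlockingPair I S)
    (hS : S.card = 1) {n : ℕ} (hn : Fintype.card V = n) (hH : Gᶜ.edgeFinset.card + 2 ≤ n) :
    Nonempty (G ≃g (K 1).join (K (n - 2) ⊕g K 1)) := by
  obtain ⟨w, rfl⟩ := Finset.card_eq_one.1 hS
  obtain ⟨z, hz⟩ : I.Nonempty := Finset.card_pos.1 (by have := h.card_le; omega)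
  have hzw : z ≠ w := by
    rintro rfl
    exact Finset.disjoint_left.1 h.disjoint hz (by simp)
  -- Shrinking `I` to one vertex still forces `n - 2` non-edges, the whole allowance.
  have h' : G.IsBlockingPair {z} {w} := ⟨by simpa using hzw, by simp, by simp, by
    intro x hx y hxy
    rw [Finset.mem_singleton] at hx
    exact h.mem_of_adj x (hx ▸ hz) y hxy⟩
  refine nonempty_iso_join_K_sum_K_one hn hzw fun x y => ?_
  simpa using h'.adj_iff (r := n - 2) (by simp; omega) (by simp; omega) x y

/-- A single leftover vertex is nonadjacent to all of `I`, so the complement of `S` is independent.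
-/
lemma IsBlockingPair.nonempty_iso_of_card_add_le {I S : Finset V} (h : G.IsBlockingPair I S)
    {r : ℕ} (hr : I.card + S.card + r = Fintype.card V) (hr1 : r ≤ 1)
    (hle : 2 * Gᶜ.edgeFinset.card ≤ I.card * (I.card + r - 1) + r * I.card) :
    Nonempty (G ≃g (K S.card).join (mK1 (I.card + r))) := by
  refine nonempty_iso_join_mK1 Sᶜ (by rw [Finset.card_compl]; omega) (by rw [compl_compl])
    fun x y => ?_
  rw [h.adj_iff hr hle]
  have hR : ∀ x y, x ∉ I → y ∉ I → x ∉ S → y ∉ S → x = y := by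
    have hcard : ((I ∪ S)ᶜ).card ≤ 1 := by
      rw [Finset.card_compl, Finset.card_union_of_disjoint h.disjoint]
      omega
    intro x y h1 h2 h3 h4
    exact Finset.card_le_one.1 hcard x (by simp [h1, h3]) y (by simp [h2, h4])
  have hd1 : x ∈ I → x ∉ S := fun hx => Finset.disjoint_left.1 h.disjoint hx
  have hd2 : y ∈ I → y ∉ S := fun hx => Finset.disjoint_left.1 h.disjoint hx
  have := hR x y
  simp only [Finset.mem_compl]
  tauto

end Extremal

end SimpleGraph

/-! ### Comparing the forced non-edges with the edge bounds -/

theorem theorem5p1 {V : Type*} [Fintype V] [DecidableEq V] (G : SimpleGraph V)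
    [DecidableRel G.Adj] (n k d : ℕ) (hV : Fintype.card V = n) (hn : 3 ≤ n)
    (hk : 3 ≤ k) (hk_odd : Odd k) (hd : 1 ≤ d) (hdk : d < k) (hnd : n ≡ d [MOD 2]) :
    ((9 ≤ n ∨ n = 3 ∨ n = 7) → (n - 1).choose 2 + 1 ≤ G.edgeFinset.card →
      (G.IsKDCritical k d ↔
        ¬ Nonempty (G ≃g (SimpleGraph.K 1).join (SimpleGraph.K (n - 2) ⊕g SimpleGraph.K 1)))) ∧
    ((n = 4 ∨ n = 6) → (3 * (n : ℚ) ^ 2 - 2 * n) / 8 ≤ G.edgeFinset.card →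
      (G.IsKDCritical k d ↔
        ¬ Nonempty (G ≃g (SimpleGraph.K (n / 2)).join (SimpleGraph.mK1 (n / 2))))) ∧
    (n = 5 → 7 ≤ G.edgeFinset.card →
      (G.IsKDCritical k d ↔
        ¬ (Nonempty (G ≃g (SimpleGraph.K 2).join (SimpleGraph.mK1 3)) ∨
          Nonempty (G ≃g (SimpleGraph.K 1).join (SimpleGraph.K 3 ⊕g SimpleGraph.K 1))))) ∧
    (n = 8 → 22 ≤ G.edgeFinset.card →
      (G.IsKDCritical k d ↔
        ¬ (Nonempty (G ≃g (SimpleGraph.K 4).join (SimpleGraph.mK1 4)) ∨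
          Nonempty (G ≃g (SimpleGraph.K 1).join (SimpleGraph.K 6 ⊕g SimpleGraph.K 1))))) := by
  subst hV
  have hsum := G.card_edgeFinset_add_card_edgeFinset_compl
  have hstar : ∀ m, Nonempty (G ≃g (SimpleGraph.K 1).join (SimpleGraph.K m ⊕g SimpleGraph.K 1)) →
      ∃ I S, G.IsBlockingPair I S := fun m ⟨φ⟩ =>
    ⟨_, _, (SimpleGraph.isBlockingPair_join_K_sum_K_one m).map φ.symm⟩
  have hjoin : ∀ m l, 1 ≤ m → m ≤ l →
      Nonempty (G ≃g (SimpleGraph.K m).join (SimpleGraph.mK1 l)) →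
      ∃ I S, G.IsBlockingPair I S := fun m l hm hl ⟨φ⟩ =>
    ⟨_, _, (SimpleGraph.isBlockingPair_join_mK1 hm hl).map φ.symm⟩
  have key : Gᶜ.edgeFinset.card + 2 ≤ Fintype.card V → ∀ P : Prop,
      (P → ∃ I S, G.IsBlockingPair I S) →
      (∀ I S, G.IsBlockingPair I S → P) → (G.IsKDCritical k d ↔ ¬ P) := by
    intro hH P h1 h2
    constructor
    · intro hc hP
      obtain ⟨I, S, h⟩ := h1 hP
      exact h.not_isKDCritical hd hc
    · intro hP
      exact SimpleGraph.isKDCritical_of_forall_not_isBlockingPair (fun I S h => hP (h2 I S h))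
        hn hk_odd hdk hnd hH
  have hpair : ∀ I S, G.IsBlockingPair I S → ∃ r, I.card + S.card + r = Fintype.card V ∧
      1 ≤ S.card ∧ S.card ≤ I.card ∧
      I.card * (I.card + r - 1) + r * I.card ≤ 2 * Gᶜ.edgeFinset.card := by
    intro I S h
    have hle := Finset.card_le_univ (I ∪ S)
    rw [Finset.card_union_of_disjoint h.disjoint] at hle
    have hr : I.card + S.card + (Fintype.card V - (I.card + S.card)) = Fintype.card V := by omega
    exact ⟨_, hr, Finset.card_pos.2 h.nonempty, h.card_le, h.two_mul_card_le hr⟩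
  refine ⟨?_, ?_, ?_, ?_⟩
  · intro hcase he
    have hH : Gᶜ.edgeFinset.card + 2 ≤ Fintype.card V := by
      obtain ⟨m, hm⟩ : ∃ m, Fintype.card V = m + 1 := ⟨Fintype.card V - 1, by omega⟩
      rw [hm] at hsum he ⊢
      rw [Nat.choose_succ_succ' m 1, Nat.choose_one_right] at hsum
      simp only [Nat.add_sub_cancel] at he
      simp only [Nat.reduceAdd] at hsum
      omega
    refine key hH _ (hstar _) fun I S h => h.nonempty_iso_of_card_eq_one ?_ rfl hH
    obtain ⟨r, hr, h1, h2, h3⟩ := hpair I S h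
    generalize I.card = c at *
    generalize S.card = s at *
    by_contra hs
    have hlt : c * (c + r - 1) + r * c ≤ 2 * (c + s + r - 2) := by omega
    obtain ⟨c, rfl⟩ : ∃ c', c = c' + 2 := ⟨c - 2, by omega⟩
    have hc : c + 2 + r - 1 = c + 1 + r := by omega
    rw [hc] at hlt
    have hlt' : (c + 2) * (c + 1 + r) + r * (c + 2) + 4 ≤ 2 * (c + 2 + s + r) := by omega
    -- With `2 ≤ |S| ≤ |I|` the count gives `|I| ≤ 4`; the surviving sizes have `n` in `{4, 5, 6,
    -- 8}`, excluded here.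
    have hc3 : c < 3 := by
      by_contra hc3
      nlinarith
    interval_cases c <;> omega
  · intro hcase he
    rcases hcase with hcase | hcase
    · rw [hcase] at he hsum ⊢
      have he' : 5 ≤ G.edgeFinset.card := by
        norm_num at he
        exact_mod_cast he
      have hc2 : Nat.choose 4 2 = 6 := rfl
      refine key (by omega) _ (hjoin _ _ (by norm_num) (by norm_num)) fun I S h => ?_
      obtain ⟨r, hr, h1, h2, h3⟩ := hpair I S h
      -- At most one edge is missing, whereas `|S| = 1` would force `n - 2 = 2`; likewise three
      -- against four for `n = 6`.
      obtain ⟨hc, hs, rfl⟩ : I.card = 2 ∧ S.card = 2 ∧ r = 0 := by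
        have hc4 : I.card ≤ 4 := by omega
        generalize I.card = c at *
        interval_cases c <;> omega
      have := h.nonempty_iso_of_card_add_le hr (by norm_num) (by rw [hc]; omega)
      rw [hs, hc] at this
      exact this
    · rw [hcase] at he hsum ⊢
      have he' : 12 ≤ G.edgeFinset.card := by
        norm_num at he
        exact_mod_cast he
      have hc2 : Nat.choose 6 2 = 15 := rfl
      refine key (by omega) _ (hjoin _ _ (by norm_num) (by norm_num)) fun I S h => ?_
      obtain ⟨r, hr, h1, h2, h3⟩ := hpair I S h
      obtain ⟨hc, hs, rfl⟩ : I.card = 3 ∧ S.card = 3 ∧ r = 0 := by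
        have hc4 : I.card ≤ 6 := by omega
        generalize I.card = c at *
        interval_cases c <;> omega
      have := h.nonempty_iso_of_card_add_le hr (by norm_num) (by rw [hc]; omega)
      rw [hs, hc] at this
      exact this
  · intro hcase he
    have hc2 : Nat.choose 5 2 = 10 := rfl
    rw [hcase] at hsum
    refine key (by omega) _ ?_ fun I S h => ?_
    · rintro (h | h)
      exacts [hjoin _ _ (by norm_num) (by norm_num) h, hstar _ h]
    obtain ⟨r, hr, h1, h2, h3⟩ := hpair I S h
    by_cases hs : S.card = 1
    · exact Or.inr (h.nonempty_iso_of_card_eq_one hs hcase (by omega))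
    left
    -- Both `(|I|, r) = (2, 1)` and `(3, 0)` occur, and both give `K_2 ∨ 3K_1`.
    obtain ⟨hs2, hcr, hr1, hle⟩ : S.card = 2 ∧ I.card + r = 3 ∧ r ≤ 1 ∧
        6 ≤ I.card * (I.card + r - 1) + r * I.card := by
      have hc4 : I.card ≤ 5 := by omega
      generalize I.card = c at *
      interval_cases c <;> omega
    have := h.nonempty_iso_of_card_add_le hr hr1 (by omega)
    rwa [hcr, hs2] at this
  · intro hcase he
    have hc2 : Nat.choose 8 2 = 28 := rfl
    rw [hcase] at hsum
    refine key (by omega) _ ?_ fun I S h => ?_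
    · rintro (h | h)
      exacts [hjoin _ _ (by norm_num) (by norm_num) h, hstar _ h]
    obtain ⟨r, hr, h1, h2, h3⟩ := hpair I S h
    by_cases hs : S.card = 1
    · exact Or.inr (h.nonempty_iso_of_card_eq_one hs hcase (by omega))
    left
    obtain ⟨hc, hs, rfl⟩ : I.card = 4 ∧ S.card = 4 ∧ r = 0 := by
      have hc4 : I.card ≤ 8 := by omega
      generalize I.card = c at *
      interval_cases c <;> omega
    have := h.nonempty_iso_of_card_add_le hr (by norm_num) (by rw [hc]; omega)
    rw [hs, hc] at this
    exact this
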